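/- Let $(\mathcal M,\tau)=(M_2(\mathbb C),\tfrac12\mathrm{Tr})*(M_2(\mathbb C),\tfrac12\mathrm{Tr})$ be the reduced free product von Neumann algebra of two copies of $M_2(\mathbb C)$ with respect to the normalized traces, that is, the von Neumann algebra generated by the left actions of the two copies of $M_2(\mathbb C)$ on the free product Hilbert space of two copies of $\bigl(L^2(M_2(\mathbb C),\tfrac12\mathrm{Tr}),1\bigr)$. Let $M_2(\mathbb C)_{(1)}$ and $M_2(\mathbb C)_{(2)}$ be the two canonical copies of $M_2(\mathbb C)$ in $\mathcal M$. If $A\in M_2(\mathbb C)_{(1)}$ and $B\in M_2(\mathbb C)_{(2)}$ are normal, then the spectral radius of $AB$ relative to $\mathcal M$ is $$r(AB)=\sup\{|\lambda| : \lambda\in\sigma_{\mathcal M}(AB)\}=\|A\|\,\|B\|.$$ -/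

import Mathlib

open scoped ENNReal Matrix

noncomputable section

namespace FreeProductM2

/-- The basis `W₀ = 1, W₁, W₂, W₃` of `M₂(ℂ)`. It is orthonormal for the inner product
`⟨x, y⟩ = ½ Tr(x* y)` of `L²(M₂(ℂ), ½ Tr)`, and `W₀ = 1` is the canonical cyclic vector. -/
def W : Fin 4 → Matrix (Fin 2) (Fin 2) ℂ :=
  ![!![1, 0; 0, 1], !![1, 0; 0, -1], !![0, -1; 1, 0], !![0, 1; 1, 0]]

/-- The matrix coefficient `⟨W j, a W k⟩ = ½ Tr((W j)* a (W k))` of the left multiplication by `a`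
on `L²(M₂(ℂ), ½ Tr)`. -/
def coeff (a : Matrix (Fin 2) (Fin 2) ℂ) (j k : Fin 4) : ℂ :=
  (1 / 2) * ((W j)ᴴ * a * W k).trace

/-- Alternating words. The letter `(i, k)` stands for the centered basis vector `W (k + 1)` in the
`i`-th copy of `L²(M₂(ℂ), ½ Tr)`; neighbouring letters come from different copies. -/
abbrev Word : Type := {l : List (Fin 2 × Fin 3) // l.IsChain (fun p q => p.1 ≠ q.1)}

/-- The alternating words that do not begin with a letter from copy `i`. -/
abbrev Tail (i : Fin 2) : Type := {w : Word // ∀ p ∈ w.1.head?, p.1 ≠ i}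

/-- The Hilbert space of the free product of two copies of `(L²(M₂(ℂ), ½ Tr), 1)`:
the Hilbert space sum of `ℂ Ω` and of all the alternating tensor products of the spaces of
centered vectors. The words are its canonical orthonormal basis (a word stands for the elementary
tensor of its letters, and the empty word for `Ω`). -/
abbrev Fock : Type := lp (fun _ : Word => ℂ) 2

/-- The closed subspace spanned by the words that do not begin in copy `i`. -/
abbrev TailSpace (i : Fin 2) : Type := lp (fun _ : Tail i => ℂ) 2

/-- `prepend i 0 v = v`, and `prepend i (k + 1) v` is the word `(i, k) v`. This is the bijection on
bases behind the identification `L²(M₂(ℂ), ½ Tr) ⊗ TailSpace i ≅ Fock`. -/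
def prepend (i : Fin 2) (k : Fin 4) (v : Tail i) : Word :=
  Fin.cases v.1
    (fun k' => ⟨(i, k') :: v.1.1,
      List.isChain_cons.2 ⟨fun p hp => (v.2 p hp).symm, v.1.2⟩⟩) k

@[simp] lemma prepend_zero (i : Fin 2) (v : Tail i) : prepend i 0 v = v.1 := rfl

@[simp] lemma prepend_succ_val (i : Fin 2) (k : Fin 3) (v : Tail i) :
    (prepend i k.succ v).1 = (i, k) :: v.1.1 := rfl

lemma prepend_inj (i : Fin 2) {j k : Fin 4} {u v : Tail i} :
    prepend i j u = prepend i k v ↔ j = k ∧ u = v := by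
  refine ⟨fun h => ?_, fun h => by rw [h.1, h.2]⟩
  have h' := congrArg Subtype.val h
  rcases Fin.eq_zero_or_eq_succ j with rfl | ⟨j, rfl⟩ <;>
  rcases Fin.eq_zero_or_eq_succ k with rfl | ⟨k, rfl⟩
  · exact ⟨rfl, Subtype.ext h⟩
  · exfalso
    rw [prepend_zero, prepend_succ_val] at h'
    exact u.2 (i, k) (by rw [h']; rfl) rfl
  · exfalso
    rw [prepend_zero, prepend_succ_val] at h'
    exact v.2 (i, j) (by rw [← h']; rfl) rfl
  · rw [prepend_succ_val, prepend_succ_val, List.cons.injEq, Prod.mk.injEq] at h'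
    exact ⟨by rw [h'.1.2], Subtype.ext (Subtype.ext h'.2)⟩

lemma exists_prepend (i : Fin 2) (w : Word) : ∃ k v, prepend i k v = w := by
  obtain ⟨l, hl⟩ := w
  by_cases h : ∀ p ∈ l.head?, p.1 ≠ i
  · exact ⟨0, ⟨⟨l, hl⟩, h⟩, rfl⟩
  · cases l with
    | nil => simp at h
    | cons q t =>
      obtain ⟨q1, q2⟩ := q
      have hq : q1 = i := by simpa using h
      subst hq
      have := List.isChain_cons.1 hl
      exact ⟨q2.succ, ⟨⟨t, this.2⟩, fun p hp => (this.1 p hp).symm⟩, rfl⟩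

/-- The basis vector of `ℓ²(ι)` at `x`. -/
abbrev delta {ι : Type} [DecidableEq ι] (x : ι) : lp (fun _ : ι => ℂ) 2 := lp.single 2 x 1

lemma orthonormal_delta {ι : Type} [DecidableEq ι] : Orthonormal ℂ (delta (ι := ι)) := by
  rw [orthonormal_iff_ite]
  intro x y
  rw [lp.inner_single_left]
  simp [Pi.single_apply]

lemma orthonormal_prepend (i : Fin 2) (k : Fin 4) :
    Orthonormal ℂ (fun v : Tail i => (delta (prepend i k v) : Fock)) :=
  orthonormal_delta.comp _ fun _ _ h => ((prepend_inj i).1 h).2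

/-- The isometry `η ↦ W k ⊗ η` from `TailSpace i` to `Fock`: it sends the basis vector at `v` to the
one at `prepend i k v`. -/
def S (i : Fin 2) (k : Fin 4) : TailSpace i →L[ℂ] Fock :=
  (orthonormal_prepend i k).orthogonalFamily.linearIsometry.toContinuousLinearMap

lemma S_delta (i : Fin 2) (k : Fin 4) (v : Tail i) : S i k (delta v) = delta (prepend i k v) := by
  simp [S, delta]

lemma ext_delta {ι : Type} [DecidableEq ι] {F : Type*} [NormedAddCommGroup F] [NormedSpace ℂ F]
    {f g : lp (fun _ : ι => ℂ) 2 →L[ℂ] F} (h : ∀ x, f (delta x) = g (delta x)) : f = g := by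
  apply lp.ext_continuousLinearMap (by norm_num)
  intro x
  ext
  simpa using h x

lemma adjoint_S_comp_S (i : Fin 2) (j k : Fin 4) :
    (S i j).adjoint ∘L S i k = if j = k then 1 else 0 := by
  refine ext_delta fun v => ?_
  refine ext_inner_left ℂ fun y => ?_
  revert y
  suffices h : innerSL ℂ (((S i j).adjoint ∘L S i k) (delta v)) =
      innerSL ℂ ((if j = k then (1 : TailSpace i →L[ℂ] TailSpace i) else 0) (delta v)) by
    intro y
    have := congrArg (fun f => star (f y)) h
    simpa using this
  refine ext_delta fun u => ?_
  rw [innerSL_apply_apply, innerSL_apply_apply, ContinuousLinearMap.comp_apply,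
    ContinuousLinearMap.adjoint_inner_left, S_delta, S_delta,
    orthonormal_iff_ite.1 orthonormal_delta]
  simp only [prepend_inj]
  by_cases h : j = k
  · subst h
    simp [orthonormal_iff_ite.1 (orthonormal_delta (ι := Tail i)) v u]
  · simp [h, Ne.symm h]

lemma adjoint_S_prepend (i : Fin 2) (j k : Fin 4) (v : Tail i) :
    (S i j).adjoint (delta (prepend i k v)) = if j = k then delta v else 0 := by
  have := congrArg (fun f => f (delta v)) (adjoint_S_comp_S i j k)
  simp only [ContinuousLinearMap.comp_apply, S_delta] at this
  rw [this]
  split <;> rfl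

/-- The left action of the `i`-th copy of `M₂(ℂ)` on the free product Hilbert space: under
`L²(M₂(ℂ), ½ Tr) ⊗ TailSpace i ≅ Fock` it is (left multiplication by `a`) `⊗ 1`. -/
def leftAction (i : Fin 2) (a : Matrix (Fin 2) (Fin 2) ℂ) : Fock →L[ℂ] Fock :=
  ∑ j, ∑ k, coeff a j k • (S i j ∘L (S i k).adjoint)

lemma leftAction_prepend (i : Fin 2) (a : Matrix (Fin 2) (Fin 2) ℂ) (k : Fin 4) (v : Tail i) :
    leftAction i a (delta (prepend i k v)) = ∑ j, coeff a j k • delta (prepend i j v) := by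
  simp [leftAction, adjoint_S_prepend, apply_ite, S_delta]

lemma coeff_one (j k : Fin 4) : coeff 1 j k = if j = k then 1 else 0 := by
  fin_cases j <;> fin_cases k <;>
    simp [coeff, W, Matrix.trace_fin_two, Matrix.mul_apply, Fin.sum_univ_two] <;> norm_num

lemma coeff_mul (a b : Matrix (Fin 2) (Fin 2) ℂ) (j k : Fin 4) :
    coeff (a * b) j k = ∑ l, coeff a j l * coeff b l k := by
  fin_cases j <;> fin_cases k <;>
    simp [coeff, W, Matrix.trace_fin_two, Matrix.mul_apply, Fin.sum_univ_two,
      Fin.sum_univ_four] <;> ring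

lemma coeff_star (a : Matrix (Fin 2) (Fin 2) ℂ) (j k : Fin 4) :
    coeff (star a) j k = star (coeff a k j) := by
  fin_cases j <;> fin_cases k <;>
    simp [coeff, W, Matrix.trace_fin_two, Matrix.mul_apply, Fin.sum_univ_two,
      Matrix.star_apply]

lemma coeff_add (a b : Matrix (Fin 2) (Fin 2) ℂ) (j k : Fin 4) :
    coeff (a + b) j k = coeff a j k + coeff b j k := by
  simp [coeff, mul_add, add_mul]

lemma coeff_smul (c : ℂ) (a : Matrix (Fin 2) (Fin 2) ℂ) (j k : Fin 4) :
    coeff (c • a) j k = c * coeff a j k := by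
  simp [coeff]; ring

/-- Operators on `Fock` that agree on all words are equal. -/
lemma ext_prepend (i : Fin 2) {f g : Fock →L[ℂ] Fock}
    (h : ∀ k v, f (delta (prepend i k v)) = g (delta (prepend i k v))) : f = g := by
  refine ext_delta fun w => ?_
  obtain ⟨k, v, rfl⟩ := exists_prepend i w
  exact h k v

lemma leftAction_one (i : Fin 2) : leftAction i 1 = 1 := by
  refine ext_prepend i fun k v => ?_
  rw [leftAction_prepend]
  simp [coeff_one]

lemma leftAction_mul (i : Fin 2) (a b : Matrix (Fin 2) (Fin 2) ℂ) :
    leftAction i (a * b) = leftAction i a * leftAction i b := by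
  refine ext_prepend i fun k v => ?_
  rw [mul_apply_eq_comp]
  simp only [leftAction_prepend, map_sum, map_smul, coeff_mul, Finset.sum_smul, Finset.smul_sum,
    smul_smul]
  rw [Finset.sum_comm]
  simp only [mul_comm]

lemma leftAction_smul (i : Fin 2) (c : ℂ) (a : Matrix (Fin 2) (Fin 2) ℂ) :
    leftAction i (c • a) = c • leftAction i a := by
  simp only [leftAction, coeff_smul, mul_smul, Finset.smul_sum]

lemma leftAction_star (i : Fin 2) (a : Matrix (Fin 2) (Fin 2) ℂ) :
    leftAction i (star a) = star (leftAction i a) := by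
  simp only [leftAction, star_sum, star_smul, coeff_star]
  rw [Finset.sum_comm]
  simp [ContinuousLinearMap.star_eq_adjoint, ContinuousLinearMap.adjoint_comp]

/-- The left action as a unital `*`-representation of `M₂(ℂ)` on `Fock`. -/
def rep (i : Fin 2) : Matrix (Fin 2) (Fin 2) ℂ →⋆ₐ[ℂ] (Fock →L[ℂ] Fock) where
  toFun := leftAction i
  map_one' := leftAction_one i
  map_mul' := leftAction_mul i
  map_zero' := by simpa using leftAction_smul i 0 0
  map_add' a b := by simp [leftAction, coeff_add, add_smul, Finset.sum_add_distrib]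
  commutes' c := by
    rw [Algebra.algebraMap_eq_smul_one, leftAction_smul, leftAction_one,
      Algebra.algebraMap_eq_smul_one]
  map_star' := leftAction_star i

/-- The operators on `Fock` that come from one of the two copies of `M₂(ℂ)`. -/
def generators : Set (Fock →L[ℂ] Fock) := ⋃ i, Set.range (rep i)

/-- The reduced free product von Neumann algebra `(M₂(ℂ), ½ Tr) * (M₂(ℂ), ½ Tr)`: the von Neumann
algebra on the free product Hilbert space that the two copies of `M₂(ℂ)` generate, that is, their
double commutant. -/
def freeProduct : VonNeumannAlgebra Fock where
  toStarSubalgebra := StarSubalgebra.centralizer ℂ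
    (StarSubalgebra.centralizer ℂ generators : Set (Fock →L[ℂ] Fock))
  centralizer_centralizer' := by
    change Set.centralizer (Set.centralizer (SetLike.coe (StarSubalgebra.centralizer ℂ
      (StarSubalgebra.centralizer ℂ generators : Set (Fock →L[ℂ] Fock))))) =
      SetLike.coe (StarSubalgebra.centralizer ℂ
        (StarSubalgebra.centralizer ℂ generators : Set (Fock →L[ℂ] Fock)))
    rw [StarSubalgebra.coe_centralizer_centralizer, Set.centralizer_centralizer_centralizer]

/-- The free product von Neumann algebra as a type, with its `*`-algebra structure and the operator
norm. -/
abbrev FreeProduct : Type := freeProduct.toStarSubalgebra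

lemma rep_mem (i : Fin 2) (a : Matrix (Fin 2) (Fin 2) ℂ) :
    rep i a ∈ freeProduct.toStarSubalgebra :=
  StarAlgebra.adjoin_le_centralizer_centralizer ℂ generators
    (StarAlgebra.subset_adjoin ℂ generators (Set.mem_iUnion.2 ⟨i, a, rfl⟩))

/-- The embedding of `M₂(ℂ)` into the free product as its `i`-th copy. -/
def embed (i : Fin 2) : Matrix (Fin 2) (Fin 2) ℂ →⋆ₐ[ℂ] FreeProduct :=
  (rep i).codRestrict freeProduct.toStarSubalgebra (rep_mem i)

/-- The `i`-th copy of `M₂(ℂ)` in the free product. -/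
def copy (i : Fin 2) : StarSubalgebra ℂ FreeProduct := (embed i).range

end FreeProductM2
end

/-!
The upper bound is `r(AB) ≤ ‖AB‖ ≤ ‖A‖ ‖B‖`. For the lower bound let `A` and `B` come from the
matrices `a` and `b`. A normal operator has a point of its spectrum on the circle of radius its norm,
so `a` has an eigenvalue `z` with `|z| = ‖A‖` and `b` an eigenvalue `w` with `|w| = ‖B‖`.
It is enough that `z w` is in the spectrum of `AB`.

The projections `p`, `q` onto eigenlines of `a`, `b` have normalized trace `1/2`, so `s = 2p - 1` and
`t = 2q - 1` are trace-zero self-adjoint unitaries (`exists_symmetry_of_mem_spectrum`). Being free,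
they generate a copy of the regular representation of the infinite dihedral group `ℤ/2 * ℤ/2`: the
vectors obtained from `Ω` by applying the alternating words in `s` and `t` are orthonormal. This group
is amenable, so there are almost invariant vectors. Concretely, the sum `ballSum n` of the vectors of
all alternating words of length at most `n` moves by at most `2` under `s` and under `t`
(`norm_sub_ballSum_le`), while its norm tends to infinity (`le_norm_sq_ballSum`). Almost invariant
vectors lie almost in the ranges of both `p` and `q`, where `A` and `B` act as `z` and `w`,
so they are approximate eigenvectors of `AB` for the eigenvalue `z w`
(`mul_mem_spectrum_rep_mul_rep`).
-/

noncomputable section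

namespace FreeProductM2

/-! ### Symmetries attached to eigenvalues of matrices -/

/-- The symmetry is `2p - 1`, with `p` the projection onto the line of an eigenvector. -/
lemma exists_symmetry_of_mem_spectrum {a : Matrix (Fin 2) (Fin 2) ℂ} {z : ℂ}
    (hz : z ∈ spectrum ℂ a) :
    ∃ s : Matrix (Fin 2) (Fin 2) ℂ, s * s = 1 ∧ star s = s ∧ s.trace = 0 ∧
      (a - z • 1) * (1 + s) = 0 := by
  have hdet : (z • 1 - a).det = 0 := by
    rw [spectrum.mem_iff, Algebra.algebraMap_eq_smul_one, Matrix.isUnit_iff_isUnit_det] at hz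
    simpa using hz
  obtain ⟨v, hv, hav⟩ := Matrix.exists_mulVec_eq_zero_iff.2 hdet
  set n : ℂ := star v ⬝ᵥ v with hvv
  have hnstar : star n = n := by simp [hvv, dotProduct, mul_comm]
  open scoped ComplexOrder in
  have hn0 : n ≠ 0 := dotProduct_star_self_eq_zero.not.2 hv
  set p : Matrix (Fin 2) (Fin 2) ℂ := n⁻¹ • Matrix.vecMulVec v (star v) with hp
  have hpp : p * p = p := by
    rw [hp, smul_mul_smul_comm, Matrix.vecMulVec_mul_vecMulVec, ← hvv, Matrix.vecMulVec_smul,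
      smul_smul, mul_assoc, inv_mul_cancel₀ hn0, mul_one]
  have hps : star p = p := by
    rw [hp, star_smul, star_inv₀, hnstar, Matrix.star_eq_conjTranspose,
      Matrix.conjTranspose_vecMulVec, star_star]
  have hpt : p.trace = 1 := by
    rw [hp, Matrix.trace_smul, Matrix.trace_vecMulVec, dotProduct_comm, ← hvv, smul_eq_mul,
      inv_mul_cancel₀ hn0]
  have hap : (a - z • 1) * p = 0 := by
    rw [hp, Matrix.mul_smul, Matrix.mul_vecMulVec, ← neg_sub, Matrix.neg_mulVec, hav]
    simp
  refine ⟨(2 : ℂ) • p - 1, ?_, ?_, ?_, ?_⟩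
  · simp only [sub_mul, mul_sub, smul_mul_smul_comm, hpp, mul_one, one_mul]
    module
  · simp [hps]
  · simp [hpt]
  · rw [add_sub_cancel, Matrix.mul_smul, hap, smul_zero]

/-! ### Alternating words in two free symmetries -/

/-- The span of the words of length `n` that do not begin in copy `i`. -/
def tailSpan (i : Fin 2) (n : ℕ) : Submodule ℂ Fock :=
  Submodule.span ℂ (delta '' {w : Word | w.1.length = n ∧ ∀ p ∈ w.1.head?, p.1 ≠ i})

/-- The span of the words of length at most `n`. -/
def ballSpan (n : ℕ) : Submodule ℂ Fock :=
  Submodule.span ℂ (delta '' {w : Word | w.1.length ≤ n})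

lemma tailSpan_le_ballSpan (i : Fin 2) {m n : ℕ} (h : m ≤ n) : tailSpan i m ≤ ballSpan n :=
  Submodule.span_mono (Set.image_mono fun _ hw => hw.1.trans_le h)

lemma ballSpan_mono {m n : ℕ} (h : m ≤ n) : ballSpan m ≤ ballSpan n :=
  Submodule.span_mono (Set.image_mono fun _ hw => le_trans hw h)

lemma isOrtho_span_delta {X Y : Set Word} (h : Disjoint X Y) :
    Submodule.span ℂ (delta '' X : Set Fock) ⟂ Submodule.span ℂ (delta '' Y) := by
  rw [Submodule.isOrtho_span]
  rintro _ ⟨x, hx, rfl⟩ _ ⟨y, hy, rfl⟩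
  exact orthonormal_delta.inner_eq_zero fun e => h.ne_of_mem hx hy e

lemma ballSpan_isOrtho_tailSpan (i : Fin 2) {m n : ℕ} (h : m < n) :
    ballSpan m ⟂ tailSpan i n :=
  isOrtho_span_delta <| Set.disjoint_left.2 fun w hw hw' => by
    simp only [Set.mem_ofPred_eq] at hw hw'
    omega

lemma tailSpan_zero_isOrtho_tailSpan_one (n : ℕ) : tailSpan 0 (n + 1) ⟂ tailSpan 1 (n + 1) :=
  isOrtho_span_delta <| Set.disjoint_left.2 fun ⟨w, _⟩ hw hw' => by
    cases w with
    | nil => simp at hw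
    | cons q t =>
      have h0 : q.1 ≠ 0 := hw.2 q rfl
      have h1 : q.1 ≠ 1 := hw'.2 q rfl
      omega

/-- A centered matrix of copy `i` puts a letter of copy `i` in front of a word that does not begin in
copy `i`. -/
lemma leftAction_mem_tailSpan {i j : Fin 2} (hij : i ≠ j) {s : Matrix (Fin 2) (Fin 2) ℂ}
    (hs : s.trace = 0) {n : ℕ} {x : Fock} (hx : x ∈ tailSpan i n) :
    leftAction i s x ∈ tailSpan j (n + 1) := by
  induction hx using Submodule.span_induction with
  | mem x hx =>
    obtain ⟨w, ⟨hw, hw'⟩, rfl⟩ := hx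
    have h := leftAction_prepend i s 0 ⟨w, hw'⟩
    rw [prepend_zero] at h
    rw [h]
    refine Submodule.sum_mem _ fun k _ => ?_
    rcases Fin.eq_zero_or_eq_succ k with rfl | ⟨k, rfl⟩
    · have hW : W 0 = 1 := Matrix.one_fin_two.symm
      have : coeff s 0 0 = 0 := by simp [coeff, hW, hs]
      rw [this, zero_smul]
      exact Submodule.zero_mem _
    · refine Submodule.smul_mem _ _ (Submodule.subset_span ⟨_, ⟨?_, ?_⟩, rfl⟩)
      · simp [hw]
      · simpa using hij
  | zero => simp
  | add x y _ _ hx hy => rw [map_add]; exact Submodule.add_mem _ hx hy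
  | smul c x _ hx => rw [map_smul]; exact Submodule.smul_mem _ _ hx

/-- The vacuum vector `Ω`. -/
def vacuum : Fock := delta (⟨[], List.isChain_nil⟩ : Word)

/-- For `s 0`, `s 1` in the two copies, the vector `s i * s (1 - i) * s i * ⋯ Ω` with `n` factors. -/
def alternating (s : Fin 2 → Matrix (Fin 2) (Fin 2) ℂ) (i : Fin 2) : ℕ → Fock
  | 0 => vacuum
  | n + 1 => leftAction i (s i) (alternating s (1 - i) n)

/-- The sum of the vectors of all alternating words in `s 0`, `s 1` of length at most `n`, with the
empty word counted once. -/
def ballSum (s : Fin 2 → Matrix (Fin 2) (Fin 2) ℂ) : ℕ → Fock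
  | 0 => vacuum
  | n + 1 => ballSum s n + (alternating s 0 (n + 1) + alternating s 1 (n + 1))

variable {s : Fin 2 → Matrix (Fin 2) (Fin 2) ℂ}

lemma alternating_mem_tailSpan (hs : ∀ i, (s i).trace = 0) (i : Fin 2) (n : ℕ) :
    alternating s i n ∈ tailSpan (1 - i) n := by
  induction n generalizing i with
  | zero => exact Submodule.subset_span ⟨_, ⟨rfl, by simp⟩, rfl⟩
  | succ n ih =>
    refine leftAction_mem_tailSpan (by decide +revert) (hs i) ?_
    simpa using ih (1 - i)

lemma leftAction_leftAction_self (i : Fin 2) {a : Matrix (Fin 2) (Fin 2) ℂ} (ha : a * a = 1)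
    (x : Fock) : leftAction i a (leftAction i a x) = x := by
  rw [← mul_apply_eq_comp, ← leftAction_mul, ha, leftAction_one]
  rfl

lemma norm_leftAction_of_symmetry (i : Fin 2) {a : Matrix (Fin 2) (Fin 2) ℂ} (ha : a * a = 1)
    (hsa : star a = a) (x : Fock) : ‖leftAction i a x‖ = ‖x‖ := by
  have h : inner ℂ (leftAction i a x) (leftAction i a x) = inner ℂ x x := by
    rw [← ContinuousLinearMap.adjoint_inner_left, ← ContinuousLinearMap.star_eq_adjoint,
      ← leftAction_star, hsa, leftAction_leftAction_self i ha]
  rw [@norm_eq_sqrt_re_inner ℂ, @norm_eq_sqrt_re_inner ℂ _ _ _ _ x, h]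

lemma norm_alternating (hss : ∀ i, s i * s i = 1) (hsa : ∀ i, star (s i) = s i) (i : Fin 2) (n : ℕ) :
    ‖alternating s i n‖ = 1 := by
  induction n generalizing i with
  | zero => exact orthonormal_delta.1 _
  | succ n ih => rw [alternating, norm_leftAction_of_symmetry i (hss i) (hsa i), ih]

lemma ballSum_mem_ballSpan (hs : ∀ i, (s i).trace = 0) (n : ℕ) : ballSum s n ∈ ballSpan n := by
  induction n with
  | zero => exact Submodule.subset_span ⟨_, by simp, rfl⟩
  | succ n ih =>
    exact Submodule.add_mem _ (ballSpan_mono n.le_succ ih) (Submodule.add_mem _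
      (tailSpan_le_ballSpan _ le_rfl (alternating_mem_tailSpan hs 0 _))
      (tailSpan_le_ballSpan _ le_rfl (alternating_mem_tailSpan hs 1 _)))

lemma le_norm_sq_ballSum (hs : ∀ i, (s i).trace = 0) (hss : ∀ i, s i * s i = 1)
    (hsa : ∀ i, star (s i) = s i) (n : ℕ) : (n : ℝ) ≤ ‖ballSum s n‖ ^ 2 := by
  induction n with
  | zero => simp
  | succ n ih =>
    have h0 := alternating_mem_tailSpan hs 0 (n + 1)
    have h1 := alternating_mem_tailSpan hs 1 (n + 1)
    have hb := ballSum_mem_ballSpan hs n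
    have horth : inner ℂ (ballSum s n) (alternating s 0 (n + 1) + alternating s 1 (n + 1)) = 0 := by
      rw [inner_add_right, (ballSpan_isOrtho_tailSpan _ n.lt_succ_self).inner_eq hb h0,
        (ballSpan_isOrtho_tailSpan _ n.lt_succ_self).inner_eq hb h1, add_zero]
    have horth' : inner ℂ (alternating s 0 (n + 1)) (alternating s 1 (n + 1)) = 0 :=
      (tailSpan_zero_isOrtho_tailSpan_one n).symm.inner_eq h0 h1
    have e := norm_add_sq_eq_norm_sq_add_norm_sq_of_inner_eq_zero _ _ horth
    have e' := norm_add_sq_eq_norm_sq_add_norm_sq_of_inner_eq_zero _ _ horth'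
    rw [norm_alternating hss hsa, norm_alternating hss hsa] at e'
    rw [ballSum]
    push_cast
    nlinarith

/-- Applying `s i` permutes the summands, up to one summand that enters and one that leaves. -/
lemma leftAction_ballSum (hss : ∀ i, s i * s i = 1) (i : Fin 2) (n : ℕ) :
    leftAction i (s i) (ballSum s n) =
      ballSum s n + (alternating s i (n + 1) - alternating s (1 - i) n) := by
  induction n with
  | zero => simp [ballSum, alternating]
  | succ n ih =>
    have h1 : leftAction i (s i) (alternating s i (n + 1)) = alternating s (1 - i) n :=
      leftAction_leftAction_self i (hss i) _
    have h2 : leftAction i (s i) (alternating s (1 - i) (n + 1)) = alternating s i (n + 1 + 1) :=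
      (alternating.eq_2 s i (n + 1)).symm
    have h3 : alternating s 0 (n + 1) + alternating s 1 (n + 1) =
        alternating s i (n + 1) + alternating s (1 - i) (n + 1) := by
      fin_cases i
      · rfl
      · exact add_comm _ _
    rw [ballSum, h3, map_add, map_add, h1, h2, ih]
    abel

lemma norm_sub_ballSum_le (hss : ∀ i, s i * s i = 1) (hsa : ∀ i, star (s i) = s i) (i : Fin 2)
    (n : ℕ) : ‖leftAction i (s i) (ballSum s n) - ballSum s n‖ ≤ 2 := by
  rw [leftAction_ballSum hss, add_sub_cancel_left]
  refine (norm_sub_le _ _).trans ?_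
  rw [norm_alternating hss hsa, norm_alternating hss hsa]
  norm_num

/-! ### Approximate eigenvectors -/

/-- If `(a - z)(1 + s) = 0`, then vectors almost fixed by `s` are approximate eigenvectors of `a`. -/
lemma norm_rep_sub_smul_le (i : Fin 2) {a s : Matrix (Fin 2) (Fin 2) ℂ} {z : ℂ}
    (h : (a - z • 1) * (1 + s) = 0) {x : Fock} (hx : ‖leftAction i s x - x‖ ≤ 2) :
    ‖rep i a x - z • x‖ ≤ ‖rep i a - z • 1‖ := by
  have h' : (rep i a - z • 1) (x + rep i s x) = 0 := by
    have := congrArg (fun m => rep i m x) h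
    simpa [map_mul] using this
  have e : rep i a x - z • x = (rep i a - z • 1) ((-2⁻¹ : ℂ) • (leftAction i s x - x)) := by
    have : (-2⁻¹ : ℂ) • (leftAction i s x - x) = x - (2⁻¹ : ℂ) • (x + leftAction i s x) := by
      module
    rw [this, map_sub, map_smul, show leftAction i s x = rep i s x from rfl, h', smul_zero, sub_zero]
    rfl
  rw [e]
  refine (ContinuousLinearMap.le_opNorm _ _).trans (mul_le_of_le_one_right (norm_nonneg _) ?_)
  rw [norm_smul, norm_neg, norm_inv, Complex.norm_ofNat]
  linarith

/-- Eigenvalues of matrices in the two copies multiply to a point of the spectrum of the product. -/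
lemma mul_mem_spectrum_rep_mul_rep {a b : Matrix (Fin 2) (Fin 2) ℂ} {z w : ℂ}
    (hz : z ∈ spectrum ℂ a) (hw : w ∈ spectrum ℂ b) :
    z * w ∈ spectrum ℂ (rep 0 a * rep 1 b) := by
  obtain ⟨s, hss, hsa, hst, hs⟩ := exists_symmetry_of_mem_spectrum hz
  obtain ⟨t, htt, hta, htt', ht⟩ := exists_symmetry_of_mem_spectrum hw
  set σ : Fin 2 → Matrix (Fin 2) (Fin 2) ℂ := ![s, t] with hσ
  have hmul : ∀ i, σ i * σ i = 1 := Fin.forall_fin_two.2 ⟨hss, htt⟩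
  have hstar : ∀ i, star (σ i) = σ i := Fin.forall_fin_two.2 ⟨hsa, hta⟩
  have htrace : ∀ i, (σ i).trace = 0 := Fin.forall_fin_two.2 ⟨hst, htt'⟩
  rw [spectrum.mem_iff]
  rintro ⟨u, hu⟩
  set C : ℝ := ‖rep 0 a‖ * ‖rep 1 b - w • 1‖ + ‖w‖ * ‖rep 0 a - z • 1‖ with hC
  have hbound (n : ℕ) : ‖(u : Fock →L[ℂ] Fock) (ballSum σ n)‖ ≤ C := by
    set x := ballSum σ n
    have hA : ‖rep 0 a x - z • x‖ ≤ ‖rep 0 a - z • 1‖ :=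
      norm_rep_sub_smul_le 0 hs (norm_sub_ballSum_le hmul hstar 0 n)
    have hB : ‖rep 1 b x - w • x‖ ≤ ‖rep 1 b - w • 1‖ :=
      norm_rep_sub_smul_le 1 ht (norm_sub_ballSum_le hmul hstar 1 n)
    have e : (u : Fock →L[ℂ] Fock) x =
        -(rep 0 a (rep 1 b x - w • x) + w • (rep 0 a x - z • x)) := by
      have h1 : (u : Fock →L[ℂ] Fock) x = (z * w) • x - rep 0 a (rep 1 b x) := by
        rw [hu, Algebra.algebraMap_eq_smul_one]
        rfl
      rw [h1, map_sub, map_smul]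
      module
    rw [e, norm_neg]
    refine (norm_add_le _ _).trans (add_le_add ?_ ?_)
    · exact (ContinuousLinearMap.le_opNorm _ _).trans
        (mul_le_mul_of_nonneg_left hB (norm_nonneg _))
    · rw [norm_smul]
      exact mul_le_mul_of_nonneg_left hA (norm_nonneg _)
  set R : Fock →L[ℂ] Fock := ((u⁻¹ : (Fock →L[ℂ] Fock)ˣ) : Fock →L[ℂ] Fock)
  have hx (n : ℕ) : ‖ballSum σ n‖ ≤ ‖R‖ * C := by
    have e : R ((u : Fock →L[ℂ] Fock) (ballSum σ n)) = ballSum σ n := by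
      rw [← mul_apply_eq_comp, Units.inv_mul]
      rfl
    calc ‖ballSum σ n‖ = ‖R ((u : Fock →L[ℂ] Fock) (ballSum σ n))‖ := by rw [e]
      _ ≤ ‖R‖ * ‖(u : Fock →L[ℂ] Fock) (ballSum σ n)‖ := ContinuousLinearMap.le_opNorm _ _
      _ ≤ ‖R‖ * C := mul_le_mul_of_nonneg_left (hbound n) (norm_nonneg _)
  obtain ⟨n, hn⟩ := exists_nat_gt ((‖R‖ * C) ^ 2)
  have := le_norm_sq_ballSum htrace hmul hstar n
  have := pow_le_pow_left₀ (norm_nonneg _) (hx n) 2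
  linarith

/-! ### Norms and spectra in the free product -/

instance : Nontrivial Fock := by
  refine ⟨vacuum, 0, fun h => ?_⟩
  have h1 : ‖vacuum‖ = 1 := orthonormal_delta.1 _
  rw [h, norm_zero] at h1
  exact zero_ne_one h1

/-- The spectrum of the image of `a` consists of eigenvalues of `a`, and for a normal operator it
attains the norm. -/
lemma exists_mem_spectrum_norm_eq (i : Fin 2) {a : Matrix (Fin 2) (Fin 2) ℂ}
    (ha : IsStarNormal (rep i a)) : ∃ z ∈ spectrum ℂ a, ‖z‖ = ‖rep i a‖ := by
  obtain ⟨z, hz, hz'⟩ := spectrum.exists_nnnorm_eq_spectralRadius (rep i a)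
  rw [IsStarNormal.spectralRadius_eq_nnnorm, ENNReal.coe_inj] at hz'
  exact ⟨z, AlgHom.spectrum_apply_subset (rep i) a hz, congrArg NNReal.toReal hz'⟩

instance : CompleteSpace FreeProduct := by
  have h : IsClosed (freeProduct.toStarSubalgebra : Set (Fock →L[ℂ] Fock)) := by
    exact Set.isClosed_centralizer _
  exact h.completeSpace_coe

end FreeProductM2
end

theorem corollary3p2 (A B : FreeProductM2.FreeProduct)
    (hA : A ∈ FreeProductM2.copy 0) (hB : B ∈ FreeProductM2.copy 1)
    (hAn : IsStarNormal A) (hBn : IsStarNormal B) :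
    spectralRadius ℂ (A * B) = ENNReal.ofReal (‖A‖ * ‖B‖) := by
  open FreeProductM2 in
  obtain ⟨a, rfl⟩ := hA
  obtain ⟨b, rfl⟩ := hB
  refine le_antisymm ?_ ?_
  · refine (spectrum.spectralRadius_le_nnnorm _).trans ?_
    rw [← enorm_eq_nnnorm, ← ofReal_norm]
    exact ENNReal.ofReal_le_ofReal (norm_mul_le _ _)
  · have hA : IsStarNormal (rep 0 a) := hAn.map freeProduct.toStarSubalgebra.subtype
    have hB : IsStarNormal (rep 1 b) := hBn.map freeProduct.toStarSubalgebra.subtype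
    obtain ⟨z, hz, hza⟩ := exists_mem_spectrum_norm_eq 0 hA
    obtain ⟨w, hw, hwb⟩ := exists_mem_spectrum_norm_eq 1 hB
    -- The spectrum can only grow on passing to the subalgebra `FreeProduct`.
    have hmem : z * w ∈ spectrum ℂ (embed 0 a * embed 1 b) :=
      AlgHom.spectrum_apply_subset freeProduct.toStarSubalgebra.subtype _
        (mul_mem_spectrum_rep_mul_rep hz hw)
    have hle : (‖z * w‖₊ : ℝ≥0∞) ≤ spectralRadius ℂ (embed 0 a * embed 1 b) :=
      le_iSup₂ (α := ℝ≥0∞) (f := fun k _ => (‖k‖₊ : ℝ≥0∞)) (z * w) hmem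
    refine le_trans (le_of_eq ?_) hle
    rw [← enorm_eq_nnnorm, ← ofReal_norm, norm_mul, hza, hwb]
    rfl
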